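/- Let $\lambda,j,\alpha\in\mathbb R$ with $\alpha>0$, $\lambda\neq\frac14$, $j\neq0$, and put $\mathcal A_{\bar\phi}=\dfrac{j}{\lambda-1/4}$. Consider, in cylindrical coordinates with $r>0$ and periodic angle of period $2\pi$, the rotating Lewis metric of the Weyl class in canonical form $$g_{\rm rot}=-\frac{r^{4\lambda}}{\alpha}\,(dt-\mathcal A_{\bar\phi}\,d\bar\phi)^2+r^{4\lambda(2\lambda-1)}(dr^2+dz^2)+\alpha\, r^{2(1-2\lambda)}\,d\bar\phi^2$$ and, for $a>0$ and $n\in\mathbb R$, the static Levi-Civita metric $$g_{\rm LC}^{a,n}=-a\,r^{1-n}\,dt^2+r^{(n^2-1)/2}(dr^2+dz^2)+\frac{r^{1+n}}{a}\,d\phi^2 .$$ 1. (Same manifold.) The map $P(t,r,\phi,z)=(t,r\cos\phi,r\sin\phi,z)$ is a local diffeomorphism of $\{r>0\}\subset\mathbb R^4$ onto $M=\mathbb R\times(\mathbb R^3\setminus\{r=0\})$ ($\mathbb R^3$ without the $z$-axis), and two points have the same image exactly when they differ by a shift of $\phi$ by an integer multiple of $2\pi$. Both $g_{\rm rot}$ and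 every $g_{\rm LC}^{a,n}$ are smooth Lorentzian metrics on this same manifold $M$ (with pullbacks under $P$ given by the line elements above). 2. (Local isometry.) The transformation $t'=t-\mathcal A_{\bar\phi}\bar\phi$, $r'=r$, $\phi'=\bar\phi$, $z'=z$ carries the line element of $g_{\rm rot}$ into that of $g_{\rm LC}:=g_{\rm LC}^{a,n}$ with $a=\alpha^{-1}$, $n=1-4\lambda$. Near every point, each of its branches is an isometry of an open subset of $(M,g_{\rm rot})$ onto an open subset of $(M,g_{\rm LC})$. 3. (Not a global diffeomorphism.) With $2\pi$-periodic angles on both sides, the correspondence between points of $M$ which this transformation induces is neither single-valued nor injective: every point of $M$ corresponds to at least two distinct image points, and every point of $M$ is an image of at least two distinct points. There is no diffeomorphism of $M$ onto itself that maps every point of $M$ to one of the points corresponding to it. 4. (Locally but not globally isometric.) $(M,g_{\rm rot})$ and $(M,g_{\rm LC})$ are locally isometric: every point of either one has an open neighbourhood isometric to an open subset of the other. But they are not globally isometric: there is no diffeomorphism $F:M\to M$ with $F^*g_{\rm LC}=g_{\rm rot}$. In fact $(M,g_{\rm rot})$ is not globally isometric to $(M,g_{\rm LC}^{a,n})$ for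 any $a>0$ and $n\in\mathbb R$. -/

import Mathlib

open Set Filter Topology
open scoped ContDiff

noncomputable section

namespace LewisWeyl

/-- `ℝ⁴ = ℝ × ℝ³`. It carries the Cartesian coordinates `(t, x, y, z)`, and is also used for the
cylindrical coordinates `(t, r, φ, z)`. -/
abbrev R4 : Type := ℝ × (ℝ × ℝ × ℝ)

/-- Fields of bilinear forms on (subsets of) `ℝ⁴`, all tangent spaces being `ℝ⁴`. -/
abbrev BilinField : Type := R4 → R4 →L[ℝ] R4 →L[ℝ] ℝ

/-- The four coordinate projections, i.e. the constant covectors `dx⁰, dx¹, dx², dx³`. -/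
def d0 : R4 →L[ℝ] ℝ := ContinuousLinearMap.fst ℝ ℝ (ℝ × ℝ × ℝ)
def d1 : R4 →L[ℝ] ℝ :=
  (ContinuousLinearMap.fst ℝ ℝ (ℝ × ℝ)).comp (ContinuousLinearMap.snd ℝ ℝ (ℝ × ℝ × ℝ))
def d2 : R4 →L[ℝ] ℝ :=
  ((ContinuousLinearMap.fst ℝ ℝ ℝ).comp (ContinuousLinearMap.snd ℝ ℝ (ℝ × ℝ))).comp
    (ContinuousLinearMap.snd ℝ ℝ (ℝ × ℝ × ℝ))
def d3 : R4 →L[ℝ] ℝ :=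
  ((ContinuousLinearMap.snd ℝ ℝ ℝ).comp (ContinuousLinearMap.snd ℝ ℝ (ℝ × ℝ))).comp
    (ContinuousLinearMap.snd ℝ ℝ (ℝ × ℝ × ℝ))

/-- The spacetime manifold `ℝ × (ℝ³ ∖ {r = 0})`: an open subset of `ℝ⁴`. -/
def M : Set R4 := univ ×ˢ {q : ℝ × ℝ × ℝ | ¬ (q.1 = 0 ∧ q.2.1 = 0)}

/-- The domain `{(t, r, φ, z) | r > 0}` of the cylindrical coordinates, with `φ` unrolled to `ℝ`. -/
def Cyl : Set R4 := {c | 0 < c.2.1}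

/-- The cylindrical coordinates: `(t, r, φ, z) ↦ (t, r cos φ, r sin φ, z)`. -/
def cylMap (c : R4) : R4 :=
  (c.1, c.2.1 * Real.cos c.2.2.1, c.2.1 * Real.sin c.2.2.1, c.2.2.2)

/-- The function `r` on `M`. -/
def rad (p : R4) : ℝ := Real.sqrt (p.2.1 ^ 2 + p.2.2.1 ^ 2)

/-- The 1-form `dr = (x dx + y dy) / r` on `M`. -/
def dr (p : R4) : R4 →L[ℝ] ℝ := (rad p)⁻¹ • (p.2.1 • d1 + p.2.2.1 • d2)

/-- The 1-form `dφ = (x dy - y dx) / r²` on `M`. -/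
def dphi (p : R4) : R4 →L[ℝ] ℝ := (rad p ^ 2)⁻¹ • (p.2.1 • d2 - p.2.2.1 • d1)

/-- The square `η ⊗ η` of a covector. -/
def sq (η : R4 →L[ℝ] ℝ) : R4 →L[ℝ] R4 →L[ℝ] ℝ := η.smulRight η

/-- The constant `𝒜_φ = j / (lam - 1/4)`. -/
def potA (lam j : ℝ) : ℝ := j / (lam - 1 / 4)

/-- The canonical form of the Weyl class Lewis line element, with the values of `r` and of the
covectors `dt, dr, dφ, dz` at a point as arguments:
`- (r^(4 lam) / α) (dt - 𝒜_φ dφ)² + r^(4 lam (2 lam - 1)) (dr² + dz²) + α r^(2 (1 - 2 lam)) dφ²`. -/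
def weylForm (lam j α r : ℝ) (ηt ηr ηφ ηz : R4 →L[ℝ] ℝ) : R4 →L[ℝ] R4 →L[ℝ] ℝ :=
  (-(r ^ (4 * lam) / α)) • sq (ηt - potA lam j • ηφ)
    + (r ^ (4 * lam * (2 * lam - 1))) • (sq ηr + sq ηz)
    + (α * r ^ (2 * (1 - 2 * lam))) • sq ηφ

/-- The Levi-Civita line element
`- a r^(1 - n) dt² + r^((n² - 1) / 2) (dr² + dz²) + (r^(1 + n) / a) dφ²`. -/
def lcForm (a n r : ℝ) (ηt ηr ηφ ηz : R4 →L[ℝ] ℝ) : R4 →L[ℝ] R4 →L[ℝ] ℝ :=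
  (-(a * r ^ (1 - n))) • sq ηt
    + (r ^ ((n ^ 2 - 1) / 2)) • (sq ηr + sq ηz)
    + (r ^ (1 + n) / a) • sq ηφ

/-- The two line elements in the coordinates `(t, r, φ, z)`. -/
def weylLine (lam j α : ℝ) : BilinField := fun c => weylForm lam j α c.2.1 d0 d1 d2 d3
def lcLine (a n : ℝ) : BilinField := fun c => lcForm a n c.2.1 d0 d1 d2 d3

/-- The two metrics on the manifold `M`. -/
def weylMetric (lam j α : ℝ) : BilinField :=
  fun p => weylForm lam j α (rad p) d0 (dr p) (dphi p) d3
def lcMetric (a n : ℝ) : BilinField :=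
  fun p => lcForm a n (rad p) d0 (dr p) (dphi p) d3

/-- The coordinate transformation `t' = t - 𝒜_φ φ`, `r' = r`, `φ' = φ`, `z' = z`. -/
def staticTransform (lam j : ℝ) (c : R4) : R4 :=
  (c.1 - potA lam j * c.2.2.1, c.2.1, c.2.2.1, c.2.2.2)

/-- `g` is a smooth Lorentzian metric, of signature `(-,+,+,+)`, on `U`. -/
def IsLorentzianOn (g : BilinField) (U : Set R4) : Prop :=
  ContDiffOn ℝ ∞ g U ∧
  (∀ p ∈ U, ∀ u v, g p u v = g p v u) ∧
  (∀ p ∈ U, ∃ w, g p w w < 0 ∧ ∀ u, g p w u = 0 → u ≠ 0 → 0 < g p u u)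

/-- `F` pulls back `h` to `g` on `U`. -/
def PullsBackOn (F : R4 → R4) (g h : BilinField) (U : Set R4) : Prop :=
  ∀ p ∈ U, ∀ u v, h (F p) (fderiv ℝ F p u) (fderiv ℝ F p v) = g p u v

/-- `e` is a smooth diffeomorphism of the open set `e.source` onto the open set `e.target`. -/
def IsDiffeo (e : OpenPartialHomeomorph R4 R4) : Prop :=
  ContDiffOn ℝ ∞ e e.source ∧ ContDiffOn ℝ ∞ e.symm e.target

/-- `e` is an isometry of `(e.source, g)` onto `(e.target, h)`. -/
def IsIsom (g h : BilinField) (e : OpenPartialHomeomorph R4 R4) : Prop :=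
  IsDiffeo e ∧ PullsBackOn e g h e.source

/-- `(M, g)` and `(M, h)` are locally isometric: every point of either one has an open
neighbourhood isometric to an open subset of the other. -/
def LocallyIsometric (g h : BilinField) : Prop :=
  (∀ p ∈ M, ∃ e, IsIsom g h e ∧ e.source ⊆ M ∧ e.target ⊆ M ∧ p ∈ e.source) ∧
  (∀ q ∈ M, ∃ e, IsIsom g h e ∧ e.source ⊆ M ∧ e.target ⊆ M ∧ q ∈ e.target)

/-- `(M, g)` and `(M, h)` are globally isometric. -/
def GloballyIsometric (g h : BilinField) : Prop :=
  ∃ e, IsIsom g h e ∧ e.source = M ∧ e.target = M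

/-- The correspondence on `M` that `staticTransform` induces when the angle is periodic with period
`2π` on both sides: `p` is related to `q` if some coordinates `c` of `p` are transformed into
coordinates of `q`. -/
def InducedCorr (lam j : ℝ) (p q : R4) : Prop :=
  ∃ c ∈ Cyl, cylMap c = p ∧ cylMap (staticTransform lam j c) = q

end LewisWeyl

end

open LewisWeyl

/-!
In the coordinates `t' = t - 𝒜 φ`, `r`, `φ`, `z` the Weyl class line element *is* the Levi-Civita
line element with `a = α⁻¹` and `n = 1 - 4 lam` (`weylForm_eq_lcForm`). The covectors `dr`, `dφ` on
`M` are pulled back by `cylMap` to the coordinate covectors (`dr_cylDeriv`, `dphi_cylDeriv`), so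
everything local, including the Lorentzian signature, is read off from the
diagonal form `lcForm`; the local isometries are obtained by conjugating `staticTransform` with local
inverses of `cylMap` (`exists_local_isometry`).

Globally, `staticTransform` does not commute with `φ ↦ φ + 2π`, which shifts `t'` by `-2π 𝒜`. Hence
the induced correspondence has no continuous selection: along a circle around the axis the selected
angle minus the parameter would be a continuous function with values in `2π ℤ` which is not constant
(`no_continuous_selection`).

The metrics are told apart by closed timelike curves. The Weyl class metric has one: as `𝒜 ≠ 0` and
`lam ≠ 1 / 4`, the circle around the axis of a suitable radius `R` satisfies
`α R ^ (2 - 4 lam) < 𝒜² R ^ (4 lam) / α` (`exists_timelike_circle`). A Levi-Civita metric has none,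
since `dt ≠ 0` on its timelike vectors, while `t` has a critical point on every closed curve
(`not_globallyIsometric`).
-/

noncomputable section

namespace LewisWeyl

/-! ### Coordinate covectors and line elements -/

@[simp] lemma d0_apply (u : R4) : d0 u = u.1 := rfl
@[simp] lemma d1_apply (u : R4) : d1 u = u.2.1 := rfl
@[simp] lemma d2_apply (u : R4) : d2 u = u.2.2.1 := rfl
@[simp] lemma d3_apply (u : R4) : d3 u = u.2.2.2 := rfl

@[simp] lemma sq_apply (η : R4 →L[ℝ] ℝ) (u v : R4) : sq η u v = η u * η v := rfl

lemma lcForm_apply (a n r : ℝ) (ηt ηr ηφ ηz : R4 →L[ℝ] ℝ) (u v : R4) :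
    lcForm a n r ηt ηr ηφ ηz u v =
      -(a * r ^ (1 - n)) * (ηt u * ηt v)
        + r ^ ((n ^ 2 - 1) / 2) * (ηr u * ηr v + ηz u * ηz v)
        + r ^ (1 + n) / a * (ηφ u * ηφ v) := by
  simp [lcForm, mul_add]

/-- The Weyl class line element is the Levi-Civita one, with `dt - 𝒜 dφ` in the place of `dt`. -/
lemma weylForm_eq_lcForm (lam j α r : ℝ) (ηt ηr ηφ ηz : R4 →L[ℝ] ℝ) :
    weylForm lam j α r ηt ηr ηφ ηz =
      lcForm α⁻¹ (1 - 4 * lam) r (ηt - potA lam j • ηφ) ηr ηφ ηz := by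
  have h1 : 1 - (1 - 4 * lam) = 4 * lam := by ring
  have h2 : ((1 - 4 * lam) ^ 2 - 1) / 2 = 4 * lam * (2 * lam - 1) := by ring
  have h3 : 1 + (1 - 4 * lam) = 2 * (1 - 2 * lam) := by ring
  rw [weylForm, lcForm, h1, h2, h3, div_inv_eq_mul, div_eq_inv_mul, mul_comm α]

lemma lcForm_symm (a n r : ℝ) (ηt ηr ηφ ηz : R4 →L[ℝ] ℝ) (u v : R4) :
    lcForm a n r ηt ηr ηφ ηz u v = lcForm a n r ηt ηr ηφ ηz v u := by
  simp only [lcForm_apply]; ring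

/-- On the kernel of `ηt` the Levi-Civita form is positive semidefinite. -/
lemma lcForm_nonneg {a r : ℝ} (ha : 0 < a) (hr : 0 ≤ r) (n : ℝ) {ηt ηr ηφ ηz : R4 →L[ℝ] ℝ}
    {u : R4} (hu : ηt u = 0) : 0 ≤ lcForm a n r ηt ηr ηφ ηz u u := by
  rw [lcForm_apply, hu]
  have h1 := Real.rpow_nonneg hr ((n ^ 2 - 1) / 2)
  have h2 := Real.rpow_nonneg hr (1 + n)
  have h3 := mul_nonneg h1 (add_nonneg (mul_self_nonneg (ηr u)) (mul_self_nonneg (ηz u)))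
  have h4 := mul_nonneg (div_nonneg h2 ha.le) (mul_self_nonneg (ηφ u))
  linarith

/-- If `ηt, ηr, ηφ, ηz` is a coframe, the Levi-Civita form is definite on the kernel of `ηt`. -/
lemma lcForm_pos {a r : ℝ} (ha : 0 < a) (hr : 0 < r) (n : ℝ) {ηt ηr ηφ ηz : R4 →L[ℝ] ℝ}
    {u : R4} (hu : ηt u = 0) (hne : ¬ (ηr u = 0 ∧ ηφ u = 0 ∧ ηz u = 0)) :
    0 < lcForm a n r ηt ηr ηφ ηz u u := by
  refine lt_of_le_of_ne (lcForm_nonneg ha hr.le n hu) fun h => hne ?_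
  rw [lcForm_apply, hu] at h
  have h1 := Real.rpow_pos_of_pos hr ((n ^ 2 - 1) / 2)
  have h2 := div_pos (Real.rpow_pos_of_pos hr (1 + n)) ha
  have hR := mul_nonneg h1.le (mul_self_nonneg (ηr u))
  have hZ := mul_nonneg h1.le (mul_self_nonneg (ηz u))
  have hΦ := mul_nonneg h2.le (mul_self_nonneg (ηφ u))
  refine ⟨?_, ?_, ?_⟩
  · exact mul_self_eq_zero.1 ((mul_eq_zero.1 (by linarith :
      r ^ ((n ^ 2 - 1) / 2) * (ηr u * ηr u) = 0)).resolve_left h1.ne')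
  · exact mul_self_eq_zero.1 ((mul_eq_zero.1 (by linarith :
      r ^ (1 + n) / a * (ηφ u * ηφ u) = 0)).resolve_left h2.ne')
  · exact mul_self_eq_zero.1 ((mul_eq_zero.1 (by linarith :
      r ^ ((n ^ 2 - 1) / 2) * (ηz u * ηz u) = 0)).resolve_left h1.ne')

/-! ### Cylindrical coordinates -/

lemma isOpen_Cyl : IsOpen Cyl :=
  isOpen_lt continuous_const (by fun_prop)

lemma rad_pos {p : R4} (hp : p ∈ M) : 0 < rad p := by
  refine Real.sqrt_pos.2 (lt_of_le_of_ne (by positivity) fun h => hp.2 ⟨?_, ?_⟩) <;>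
    nlinarith [sq_nonneg p.2.1, sq_nonneg p.2.2.1]

lemma rad_sq (p : R4) : rad p ^ 2 = p.2.1 ^ 2 + p.2.2.1 ^ 2 :=
  Real.sq_sqrt (by positivity)

lemma rad_cylMap {c : R4} (hc : c ∈ Cyl) : rad (cylMap c) = c.2.1 := by
  have h : (c.2.1 * Real.cos c.2.2.1) ^ 2 + (c.2.1 * Real.sin c.2.2.1) ^ 2 = c.2.1 ^ 2 := by
    linear_combination c.2.1 ^ 2 * Real.sin_sq_add_cos_sq c.2.2.1
  simp only [rad, cylMap, h]
  exact Real.sqrt_sq (le_of_lt hc)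

lemma cylMap_mem {c : R4} (hc : c ∈ Cyl) : cylMap c ∈ M := by
  refine ⟨trivial, fun h => ?_⟩
  have h1 := rad_cylMap hc
  rw [rad, h.1, h.2] at h1
  have h2 : 0 < c.2.1 := hc
  simp at h1
  linarith

lemma exists_cylMap_eq {p : R4} (hp : p ∈ M) : ∃ c ∈ Cyl, cylMap c = p := by
  obtain ⟨t, x, y, z⟩ := p
  have hw : (⟨x, y⟩ : ℂ) ≠ 0 := fun h => hp.2 (by simpa [Complex.ext_iff] using h)
  refine ⟨(t, ‖(⟨x, y⟩ : ℂ)‖, Complex.arg ⟨x, y⟩, z), norm_pos_iff.2 hw, ?_⟩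
  simp only [cylMap, Complex.norm_mul_cos_arg, Complex.norm_mul_sin_arg]

lemma cylMap_image : cylMap '' Cyl = M := by
  ext p
  exact ⟨by rintro ⟨c, hc, rfl⟩; exact cylMap_mem hc, exists_cylMap_eq⟩

lemma cylMap_add_period (c : R4) (k : ℤ) : cylMap (c + (0, 0, 2 * Real.pi * k, 0)) = cylMap c := by
  have h : c.2.2.1 + 2 * Real.pi * k = c.2.2.1 + k * (2 * Real.pi) := by ring
  simp [cylMap, h, Real.cos_add_int_mul_two_pi, Real.sin_add_int_mul_two_pi]

lemma cylMap_eq_iff {c c' : R4} (hc : c ∈ Cyl) (hc' : c' ∈ Cyl) :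
    cylMap c = cylMap c' ↔ ∃ k : ℤ, c' = c + (0, 0, 2 * Real.pi * k, 0) := by
  constructor
  · intro h
    have hr : c.2.1 = c'.2.1 := by rw [← rad_cylMap hc, ← rad_cylMap hc', h]
    have hr0 : c'.2.1 ≠ 0 := (show 0 < c'.2.1 from hc').ne'
    simp only [cylMap, Prod.mk.injEq, hr, mul_right_inj' hr0] at h
    obtain ⟨ht, hcos, hsin, hz⟩ := h
    obtain ⟨k, hk⟩ :=
      Real.Angle.angle_eq_iff_two_pi_dvd_sub.1 (Real.Angle.cos_sin_inj hcos.symm hsin.symm)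
    refine ⟨k, Prod.ext ?_ (Prod.ext ?_ (Prod.ext ?_ ?_))⟩ <;> simp <;> linarith
  · rintro ⟨k, rfl⟩
    exact (cylMap_add_period c k).symm

/-- The derivative of `cylMap` at `c`. -/
def cylDeriv (c : R4) : R4 →L[ℝ] R4 :=
  d0.prod ((Real.cos c.2.2.1 • d1 - (c.2.1 * Real.sin c.2.2.1) • d2).prod
    ((Real.sin c.2.2.1 • d1 + (c.2.1 * Real.cos c.2.2.1) • d2).prod d3))

/-- The coframe `(dt, dr, dφ, dz)` at a point of `M`, as a linear map: the derivative of a local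
inverse of `cylMap`. -/
def cylInv (p : R4) : R4 →L[ℝ] R4 :=
  d0.prod ((dr p).prod ((dphi p).prod d3))

lemma d1_cylInv (p u : R4) : (cylInv p u).2.1 = dr p u := rfl
lemma d2_cylInv (p u : R4) : (cylInv p u).2.2.1 = dphi p u := rfl

lemma cylInv_cylDeriv {c : R4} (hc : c ∈ Cyl) (u : R4) :
    cylInv (cylMap c) (cylDeriv c u) = u := by
  have hr : c.2.1 ≠ 0 := (show 0 < c.2.1 from hc).ne'
  have hcs := Real.sin_sq_add_cos_sq c.2.2.1
  refine Prod.ext rfl (Prod.ext ?_ (Prod.ext ?_ rfl))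
  · rw [d1_cylInv, dr, rad_cylMap hc]
    simp [cylDeriv, cylMap]
    field_simp
    linear_combination u.2.1 * hcs
  · rw [d2_cylInv, dphi, rad_cylMap hc]
    simp [cylDeriv, cylMap]
    field_simp
    linear_combination u.2.2.1 * c.2.1 * hcs

lemma cylDeriv_cylInv {c : R4} (hc : c ∈ Cyl) (u : R4) :
    cylDeriv c (cylInv (cylMap c) u) = u := by
  -- a left inverse of an endomorphism of a finite-dimensional space is a right inverse
  have h : (cylInv (cylMap c)).toLinearMap ∘ₗ (cylDeriv c).toLinearMap = LinearMap.id :=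
    LinearMap.ext (cylInv_cylDeriv hc)
  exact LinearMap.congr_fun ((LinearMap.comp_eq_id_comm _ _).1 h) u

/-- The derivative of `cylMap` at a point of `Cyl`, as an equivalence. -/
def cylEquiv {c : R4} (hc : c ∈ Cyl) : R4 ≃L[ℝ] R4 :=
  ContinuousLinearEquiv.equivOfInverse (cylDeriv c) (cylInv (cylMap c))
    (cylInv_cylDeriv hc) (cylDeriv_cylInv hc)

lemma contDiff_cylMap : ContDiff ℝ ∞ cylMap := by
  unfold cylMap; fun_prop

lemma hasStrictFDerivAt_cylMap (c : R4) : HasStrictFDerivAt cylMap (cylDeriv c) c := by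
  have h1 := d1.hasStrictFDerivAt (x := c)
  have h2 := d2.hasStrictFDerivAt (x := c)
  have key := d0.hasStrictFDerivAt (x := c) |>.prodMk
    ((h1.mul h2.cos).prodMk ((h1.mul h2.sin).prodMk (d3.hasStrictFDerivAt (x := c))))
  refine key.congr_fderiv ?_
  ext <;> simp [cylDeriv]

lemma fderiv_cylMap (c : R4) : fderiv ℝ cylMap c = cylDeriv c :=
  (hasStrictFDerivAt_cylMap c).hasFDerivAt.fderiv

lemma IsDiffeo.symm {e : OpenPartialHomeomorph R4 R4} (he : IsDiffeo e) : IsDiffeo e.symm :=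
  ⟨he.2, he.1⟩

lemma IsDiffeo.trans {e f : OpenPartialHomeomorph R4 R4} (he : IsDiffeo e) (hf : IsDiffeo f) :
    IsDiffeo (e.trans f) := by
  have key : ∀ {e f : OpenPartialHomeomorph R4 R4}, IsDiffeo e → IsDiffeo f →
      ContDiffOn ℝ ∞ (e.trans f) (e.trans f).source := fun he hf => by
    rw [OpenPartialHomeomorph.coe_trans, OpenPartialHomeomorph.trans_source]
    exact hf.1.comp (he.1.mono inter_subset_left) fun _ hx => hx.2
  exact ⟨key he hf, key hf.symm he.symm⟩

lemma exists_cylMap_diffeo {c : R4} (hc : c ∈ Cyl) :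
    ∃ e : OpenPartialHomeomorph R4 R4, IsDiffeo e ∧ c ∈ e.source ∧ e.source ⊆ Cyl ∧
      e.target ⊆ M ∧ Set.EqOn e cylMap e.source := by
  have hf : HasStrictFDerivAt cylMap (cylEquiv hc : R4 →L[ℝ] R4) c := hasStrictFDerivAt_cylMap c
  let e := (hf.toOpenPartialHomeomorph cylMap).restrOpen Cyl isOpen_Cyl
  have hcoe : ∀ x, e x = cylMap x := fun _ => rfl
  have hsub : e.source ⊆ Cyl := fun x hx => hx.2
  refine ⟨e, ⟨contDiff_cylMap.contDiffOn, fun y hy => ?_⟩,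
    ⟨hf.mem_toOpenPartialHomeomorph_source, hc⟩, hsub, fun y hy => ?_, fun x _ => rfl⟩
  · have hx := hsub (e.map_target hy)
    exact (e.contDiffAt_symm (f₀' := cylEquiv hx) hy
      (hasStrictFDerivAt_cylMap _).hasFDerivAt contDiff_cylMap.contDiffAt).contDiffWithinAt
  · rw [← e.right_inv hy, hcoe]
    exact cylMap_mem (hsub (e.map_target hy))

/-! ### The metrics on `M` -/

lemma contDiffOn_rad : ContDiffOn ℝ ∞ rad M := by
  refine ContDiffOn.sqrt (by fun_prop) fun p hp => ?_
  rw [← rad_sq]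
  exact (pow_pos (rad_pos hp) 2).ne'

lemma contDiffOn_dr : ContDiffOn ℝ ∞ dr M :=
  (contDiffOn_rad.inv fun _ hp => (rad_pos hp).ne').smul (by fun_prop)

lemma contDiffOn_dphi : ContDiffOn ℝ ∞ dphi M :=
  ((contDiffOn_rad.pow 2).inv fun _ hp => (pow_pos (rad_pos hp) 2).ne').smul (by fun_prop)

lemma contDiff_sq : ContDiff ℝ ∞ sq :=
  contDiff_id.smulRight contDiff_id

lemma contDiffOn_lcForm (a n : ℝ) {ηt : R4 → R4 →L[ℝ] ℝ} (ht : ContDiffOn ℝ ∞ ηt M) :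
    ContDiffOn ℝ ∞ (fun p => lcForm a n (rad p) (ηt p) (dr p) (dphi p) d3) M := by
  have hpow : ∀ s : ℝ, ContDiffOn ℝ ∞ (fun p => rad p ^ s) M := fun s =>
    contDiffOn_rad.rpow_const_of_ne fun p hp => (rad_pos hp).ne'
  have hsq : ∀ {η : R4 → R4 →L[ℝ] ℝ}, ContDiffOn ℝ ∞ η M →
      ContDiffOn ℝ ∞ (fun p => sq (η p)) M := fun h => contDiff_sq.comp_contDiffOn h
  -- unification finds this instance only when the space is given explicitly
  have : IsBoundedSMul ℝ (R4 →L[ℝ] R4 →L[ℝ] ℝ) :=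
    NormedSpace.toIsBoundedSMul (𝕜 := ℝ) (E := R4 →L[ℝ] R4 →L[ℝ] ℝ)
  exact (((contDiffOn_const.mul (hpow _)).neg.smul (hsq ht)).add
    ((hpow _).smul ((hsq contDiffOn_dr).add contDiffOn_const))).add
    (((hpow _).div_const a).smul (hsq contDiffOn_dphi))

lemma eq_zero_of_cylInv_eq_zero {p : R4} (hp : p ∈ M) {u : R4} (hu : cylInv p u = 0) : u = 0 := by
  obtain ⟨c, hc, rfl⟩ := exists_cylMap_eq hp
  rw [← cylDeriv_cylInv hc u, hu, map_zero]

/-- Signature and smoothness for the common shape of both metrics. The timelike direction is `∂ₜ`,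
whose orthogonal complement is the kernel of `ηt = dt - b dφ`. -/
lemma isLorentzianOn_lcForm {a : ℝ} (ha : 0 < a) (n b : ℝ) :
    IsLorentzianOn
      (fun p => lcForm a n (rad p) (d0 - b • dphi p) (dr p) (dphi p) d3) M := by
  refine ⟨contDiffOn_lcForm a n (contDiffOn_const.sub (contDiffOn_dphi.const_smul b)),
    fun p _ u v => lcForm_symm .., fun p hp => ⟨(1, 0, 0, 0), ?_, fun u hu hne => ?_⟩⟩
  · have := mul_pos ha (Real.rpow_pos_of_pos (rad_pos hp) (1 - n))
    simpa [lcForm_apply, dr, dphi] using this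
  · have hpos := mul_pos ha (Real.rpow_pos_of_pos (rad_pos hp) (1 - n))
    have hu0 : (d0 - b • dphi p) u = 0 := by
      have h : -(a * rad p ^ (1 - n)) * (d0 - b • dphi p) u = 0 := by
        rw [← hu]
        simp [lcForm_apply, dr, dphi]
      exact (mul_eq_zero.1 h).resolve_left (neg_ne_zero.2 hpos.ne')
    refine lcForm_pos ha (rad_pos hp) n hu0 fun ⟨h1, h2, h3⟩ =>
      hne (eq_zero_of_cylInv_eq_zero hp ?_)
    have h0 : u.1 = 0 := by simpa [h2] using hu0
    exact Prod.ext h0 (Prod.ext h1 (Prod.ext h2 h3))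

lemma isLorentzianOn_lcMetric {a : ℝ} (ha : 0 < a) (n : ℝ) : IsLorentzianOn (lcMetric a n) M := by
  have h : lcMetric a n =
      fun p => lcForm a n (rad p) (d0 - (0 : ℝ) • dphi p) (dr p) (dphi p) d3 := by
    funext p
    rw [lcMetric, zero_smul, sub_zero]
  exact h ▸ isLorentzianOn_lcForm ha n 0

lemma isLorentzianOn_weylMetric (lam j : ℝ) {α : ℝ} (hα : 0 < α) :
    IsLorentzianOn (weylMetric lam j α) M := by
  have h : weylMetric lam j α = fun p => lcForm α⁻¹ (1 - 4 * lam) (rad p)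
      (d0 - potA lam j • dphi p) (dr p) (dphi p) d3 := by
    funext p
    rw [weylMetric, weylForm_eq_lcForm]
  exact h ▸ isLorentzianOn_lcForm (inv_pos.2 hα) (1 - 4 * lam) (potA lam j)

lemma dr_cylDeriv {c : R4} (hc : c ∈ Cyl) (u : R4) : dr (cylMap c) (cylDeriv c u) = d1 u := by
  rw [← d1_cylInv, cylInv_cylDeriv hc, d1_apply]

lemma dphi_cylDeriv {c : R4} (hc : c ∈ Cyl) (u : R4) :
    dphi (cylMap c) (cylDeriv c u) = d2 u := by
  rw [← d2_cylInv, cylInv_cylDeriv hc, d2_apply]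

lemma d0_cylDeriv (c u : R4) : d0 (cylDeriv c u) = d0 u := rfl

lemma d3_cylDeriv (c u : R4) : d3 (cylDeriv c u) = d3 u := rfl

lemma cylMap_pullsBackOn_lc (a n : ℝ) : PullsBackOn cylMap (lcLine a n) (lcMetric a n) Cyl := by
  intro c hc u v
  simp only [fderiv_cylMap, lcMetric, lcLine, lcForm_apply, rad_cylMap hc, dr_cylDeriv hc,
    dphi_cylDeriv hc, d0_cylDeriv, d3_cylDeriv]

lemma cylMap_pullsBackOn_weyl (lam j α : ℝ) :
    PullsBackOn cylMap (weylLine lam j α) (weylMetric lam j α) Cyl := by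
  intro c hc u v
  simp only [fderiv_cylMap, weylMetric, weylLine, weylForm_eq_lcForm, lcForm_apply,
    sub_apply, smul_apply, rad_cylMap hc, dr_cylDeriv hc,
    dphi_cylDeriv hc, d0_cylDeriv, d3_cylDeriv]

/-! ### The static transformation -/

lemma contDiff_staticTransform (lam j : ℝ) : ContDiff ℝ ∞ (staticTransform lam j) := by
  unfold staticTransform; fun_prop

lemma staticTransform_neg (lam j : ℝ) (c : R4) :
    staticTransform lam (-j) (staticTransform lam j c) = c := by
  simp [staticTransform, potA, neg_div]

lemma staticTransform_neg' (lam j : ℝ) (c : R4) :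
    staticTransform lam j (staticTransform lam (-j) c) = c := by
  simpa using staticTransform_neg lam (-j) c

/-- `staticTransform` as a homeomorphism of `ℝ⁴`; its inverse is the transformation for `-j`. -/
def staticHomeomorph (lam j : ℝ) : R4 ≃ₜ R4 where
  toFun := staticTransform lam j
  invFun := staticTransform lam (-j)
  left_inv := staticTransform_neg lam j
  right_inv := staticTransform_neg' lam j
  continuous_toFun := (contDiff_staticTransform lam j).continuous
  continuous_invFun := (contDiff_staticTransform lam (-j)).continuous

lemma fderiv_staticTransform (lam j : ℝ) (c u : R4) :
    fderiv ℝ (staticTransform lam j) c u = staticTransform lam j u := by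
  have h : HasFDerivAt (staticTransform lam j)
      ((d0 - potA lam j • d2).prod (d1.prod (d2.prod d3))) c :=
    ((d0 - potA lam j • d2).prod (d1.prod (d2.prod d3))).hasFDerivAt
  rw [h.fderiv]
  rfl

lemma staticTransform_pullsBackOn (lam j α : ℝ) :
    PullsBackOn (staticTransform lam j) (weylLine lam j α) (lcLine α⁻¹ (1 - 4 * lam)) Cyl := by
  intro c _ u v
  simp only [fderiv_staticTransform, weylLine, lcLine, weylForm_eq_lcForm, lcForm_apply]
  rfl

/-- A map which `cylMap` intertwines with `staticTransform` near `c` is isometric at `cylMap c`. -/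
lemma pullback_of_semiconj {lam j α : ℝ} {F : R4 → R4} {c : R4} (hc : c ∈ Cyl)
    (hF : DifferentiableAt ℝ F (cylMap c))
    (h : ∀ᶠ c' in 𝓝 c, F (cylMap c') = cylMap (staticTransform lam j c')) (u v : R4) :
    lcMetric α⁻¹ (1 - 4 * lam) (F (cylMap c))
      (fderiv ℝ F (cylMap c) u) (fderiv ℝ F (cylMap c) v) =
      weylMetric lam j α (cylMap c) u v := by
  have hP : ∀ c, DifferentiableAt ℝ cylMap c := contDiff_cylMap.differentiable (by simp)
  have hT := (contDiff_staticTransform lam j).differentiable (by simp) c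
  have hd : ∀ w, fderiv ℝ F (cylMap c) (fderiv ℝ cylMap c w) =
      fderiv ℝ cylMap (staticTransform lam j c) (fderiv ℝ (staticTransform lam j) c w) := by
    have h' : F ∘ cylMap =ᶠ[𝓝 c] cylMap ∘ staticTransform lam j := h
    have := h'.fderiv_eq (𝕜 := ℝ)
    rw [fderiv_comp c hF (hP c), fderiv_comp c (hP _) hT] at this
    exact fun w => DFunLike.congr_fun this w
  have hsurj : ∀ w, w = fderiv ℝ cylMap c (cylInv (cylMap c) w) := fun w => by
    rw [fderiv_cylMap, cylDeriv_cylInv hc]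
  have hTc : staticTransform lam j c ∈ Cyl := hc
  rw [hsurj u, hsurj v, hd, hd, h.self_of_nhds, cylMap_pullsBackOn_lc _ _ _ hTc,
    staticTransform_pullsBackOn lam j α c hc, cylMap_pullsBackOn_weyl lam j α c hc]

lemma exists_local_isometry (lam j α : ℝ) {c : R4} (hc : c ∈ Cyl) :
    ∃ e, IsIsom (weylMetric lam j α) (lcMetric α⁻¹ (1 - 4 * lam)) e ∧
      e.source ⊆ M ∧ e.target ⊆ M ∧ cylMap c ∈ e.source ∧
      ∀ᶠ c' in 𝓝 c, e (cylMap c') = cylMap (staticTransform lam j c') := by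
  have hTc : staticTransform lam j c ∈ Cyl := hc
  obtain ⟨e₁, hd₁, hm₁, hs₁, ht₁, heq₁⟩ := exists_cylMap_diffeo hc
  obtain ⟨e₂, hd₂, hm₂, hs₂, ht₂, heq₂⟩ := exists_cylMap_diffeo hTc
  let T := (staticHomeomorph lam j).toOpenPartialHomeomorph
  have hT : IsDiffeo T :=
    ⟨(contDiff_staticTransform lam j).contDiffOn, (contDiff_staticTransform lam (-j)).contDiffOn⟩
  have hTcoe : ∀ x, T x = staticTransform lam j x := fun _ => rfl
  let e := e₁.symm.trans (T.trans e₂)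
  have hsrc : ∀ p, p ∈ e.source ↔
      p ∈ e₁.target ∧ staticTransform lam j (e₁.symm p) ∈ e₂.source := fun p => by
    simp [e, T, staticHomeomorph]
  have htgt : e.target ⊆ M := fun q hq => by
    have : q ∈ e₂.target := by
      simp only [e, OpenPartialHomeomorph.trans_target] at hq
      exact hq.1.1
    exact ht₂ this
  have hdiff : IsDiffeo e := hd₁.symm.trans (hT.trans hd₂)
  -- `e` is intertwined with `staticTransform` on an open set of coordinates
  have hsemi : ∀ x ∈ e₁.source, staticTransform lam j x ∈ e₂.source →
      ∀ᶠ c' in 𝓝 x, e (cylMap c') = cylMap (staticTransform lam j c') := fun x hx hx2 => by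
    have h1 := e₁.open_source.mem_nhds hx
    have h2 := (contDiff_staticTransform lam j).continuous.continuousAt.preimage_mem_nhds
      (e₂.open_source.mem_nhds hx2)
    filter_upwards [h1, h2] with c' h1 h2
    rw [← heq₁ h1, ← heq₂ h2]
    simp [e, e₁.left_inv h1, hTcoe]
  refine ⟨e, ⟨hdiff, fun p hp u v => ?_⟩, fun p hp => ht₁ ((hsrc p).1 hp).1, htgt, ?_,
    hsemi c hm₁ hm₂⟩
  · obtain ⟨hp1, hp2⟩ := (hsrc p).1 hp
    have hx := e₁.map_target hp1
    have hpx : cylMap (e₁.symm p) = p := by rw [← heq₁ hx, e₁.right_inv hp1]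
    have hF : DifferentiableAt ℝ e p :=
      (hdiff.1.contDiffAt (e.open_source.mem_nhds hp)).differentiableAt (by simp)
    have := pullback_of_semiconj (α := α) (hs₁ hx) (by rwa [hpx]) (hsemi _ hx hp2) u v
    rwa [hpx] at this
  · rw [hsrc, ← heq₁ hm₁, e₁.left_inv hm₁]
    exact ⟨e₁.map_source hm₁, hm₂⟩

lemma locallyIsometric (lam j α : ℝ) :
    LocallyIsometric (weylMetric lam j α) (lcMetric α⁻¹ (1 - 4 * lam)) := by
  constructor
  · intro p hp
    obtain ⟨c, hc, rfl⟩ := exists_cylMap_eq hp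
    obtain ⟨e, he, hs, ht, hm, -⟩ := exists_local_isometry lam j α hc
    exact ⟨e, he, hs, ht, hm⟩
  · intro q hq
    obtain ⟨c, hc, rfl⟩ := exists_cylMap_eq hq
    have hc' : staticTransform lam (-j) c ∈ Cyl := hc
    obtain ⟨e, he, hs, ht, hm, hev⟩ := exists_local_isometry lam j α hc'
    refine ⟨e, he, hs, ht, ?_⟩
    have h := e.map_source hm
    rwa [hev.self_of_nhds, staticTransform_neg'] at h

/-! ### The induced correspondence -/

lemma potA_ne_zero {lam j : ℝ} (hlam : lam ≠ 1 / 4) (hj : j ≠ 0) : potA lam j ≠ 0 :=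
  div_ne_zero hj (sub_ne_zero.2 hlam)

/-- Going once around the axis before applying `staticTransform` shifts the time by `-2π 𝒜`. -/
lemma cylMap_staticTransform_shift_ne {lam j : ℝ} (hA : potA lam j ≠ 0) (c : R4) :
    cylMap (staticTransform lam j c) ≠
      cylMap (staticTransform lam j (c + (0, 0, 2 * Real.pi * (1 : ℤ), 0))) := by
  intro h
  have h1 := congrArg Prod.fst h
  simp [cylMap, staticTransform, mul_add, hA, Real.pi_ne_zero] at h1

lemma inducedCorr_not_single_valued {lam j : ℝ} (hA : potA lam j ≠ 0) {p : R4} (hp : p ∈ M) :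
    ∃ q q', q ≠ q' ∧ InducedCorr lam j p q ∧ InducedCorr lam j p q' := by
  obtain ⟨c, hc, rfl⟩ := exists_cylMap_eq hp
  refine ⟨_, _, cylMap_staticTransform_shift_ne hA c, ⟨c, hc, rfl, rfl⟩,
    ⟨_, ?_, cylMap_add_period c 1, rfl⟩⟩
  simpa [Cyl] using hc

/-- The correspondence for `-j` is the converse relation. -/
lemma InducedCorr.symm {lam j : ℝ} {p q : R4} (h : InducedCorr lam (-j) q p) :
    InducedCorr lam j p q := by
  obtain ⟨c, hc, rfl, rfl⟩ := h
  exact ⟨staticTransform lam (-j) c, hc, rfl, by rw [staticTransform_neg']⟩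

lemma inducedCorr_not_injective {lam j : ℝ} (hA : potA lam j ≠ 0) {q : R4} (hq : q ∈ M) :
    ∃ p p', p ≠ p' ∧ InducedCorr lam j p q ∧ InducedCorr lam j p' q := by
  have hA' : potA lam (-j) ≠ 0 := by simpa [potA, neg_div] using hA
  obtain ⟨p, p', hne, h, h'⟩ := inducedCorr_not_single_valued hA' hq
  exact ⟨p, p', hne, h.symm, h'.symm⟩

lemma no_continuous_selection {lam j : ℝ} (hA : potA lam j ≠ 0) {F : R4 → R4}
    (hF : ContinuousOn F M) : ¬ ∀ p ∈ M, InducedCorr lam j p (F p) := by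
  intro h
  let γ : ℝ → R4 := fun s => cylMap (0, 1, s, 0)
  have hγM : ∀ s, γ s ∈ M := fun s => cylMap_mem (show (0 : ℝ) < 1 from one_pos)
  have hγ : Continuous γ := contDiff_cylMap.continuous.comp (by fun_prop)
  -- the angle of the coordinates selected by `F` at `γ s`, minus `s`
  let f : ℝ → ℝ := fun s => -(F (γ s)).1 / potA lam j - s
  have hf : Continuous f := by
    have : Continuous fun s => F (γ s) := hF.comp_continuous hγ hγM
    exact (this.fst.neg.div_const _).sub continuous_id
  have hval : ∀ s, ∃ k : ℤ, f s = 2 * Real.pi * k := fun s => by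
    obtain ⟨c, hc, hcp, hcq⟩ := h _ (hγM s)
    obtain ⟨k, rfl⟩ := (cylMap_eq_iff (show (0 : ℝ) < 1 from one_pos) hc).1 hcp.symm
    refine ⟨k, ?_⟩
    simp only [f, ← hcq, cylMap, staticTransform]
    simp only [Prod.fst_add, Prod.snd_add]
    field_simp
    ring
  have hper : f (2 * Real.pi) = f 0 - 2 * Real.pi := by
    have : γ (2 * Real.pi) = γ 0 := by simp [γ, cylMap]
    simp only [f, this]; ring
  have hpi := Real.pi_pos
  obtain ⟨s, -, hs⟩ := intermediate_value_Icc' (by positivity : (0 : ℝ) ≤ 2 * Real.pi)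
    hf.continuousOn (show f 0 - Real.pi ∈ Icc (f (2 * Real.pi)) (f 0) by
      rw [hper]; constructor <;> linarith)
  obtain ⟨k, hk⟩ := hval s
  obtain ⟨l, hl⟩ := hval 0
  have h2 : Real.pi * (2 * (k : ℝ) + 1) = Real.pi * (2 * l) := by linarith
  have h3 : (2 * k + 1 : ℤ) = 2 * l := by exact_mod_cast mul_left_cancel₀ hpi.ne' h2
  omega

/-! ### Closed timelike curves -/

/-- Some circle around the axis is timelike for the Weyl class metric. -/
lemma exists_timelike_circle {lam j α : ℝ} (hα : 0 < α) (hlam : lam ≠ 1 / 4)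
    (hA : potA lam j ≠ 0) :
    ∃ R : ℝ, 0 < R ∧ ∀ t φ z, weylLine lam j α (t, R, φ, z) (0, 0, 1, 0) (0, 0, 1, 0) < 0 := by
  set A := potA lam j with hAdef
  have hs : 2 - 8 * lam ≠ 0 := fun h => hlam (by linarith)
  have hB : 0 < A ^ 2 / (2 * α ^ 2) := by positivity
  -- `R` is chosen such that `α R ^ (2 - 4 lam)` is half of `𝒜² R ^ (4 lam) / α`
  set R := (A ^ 2 / (2 * α ^ 2)) ^ (2 - 8 * lam)⁻¹ with hRdef
  have hR : 0 < R := Real.rpow_pos_of_pos hB _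
  refine ⟨R, hR, fun t φ z => ?_⟩
  have h1 : R ^ (2 - 8 * lam) = A ^ 2 / (2 * α ^ 2) := Real.rpow_inv_rpow hB.le hs
  have h2 : R ^ (2 * (1 - 2 * lam)) = R ^ (4 * lam) * (A ^ 2 / (2 * α ^ 2)) := by
    rw [← h1, ← Real.rpow_add hR]; congr 1; ring
  have h3 : 0 < R ^ (4 * lam) := Real.rpow_pos_of_pos hR _
  have h4 : weylLine lam j α (t, R, φ, z) (0, 0, 1, 0) (0, 0, 1, 0) =
      -(R ^ (4 * lam) * A ^ 2 / (2 * α)) := by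
    simp [weylLine, weylForm, h2, ← hAdef]
    field_simp
    ring
  rw [h4, neg_lt_zero]
  positivity

lemma not_globallyIsometric {lam j α : ℝ} (hα : 0 < α) (hlam : lam ≠ 1 / 4)
    (hA : potA lam j ≠ 0) {a : ℝ} (ha : 0 < a) (n : ℝ) :
    ¬ GloballyIsometric (weylMetric lam j α) (lcMetric a n) := by
  rintro ⟨e, ⟨hd, hpb⟩, hs, -⟩
  obtain ⟨R, hR, hneg⟩ := exists_timelike_circle hα hlam hA
  let κ : ℝ → R4 := fun s => (0, R, s, 0)
  have hκC : ∀ s, κ s ∈ Cyl := fun s => hR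
  have hκ : ∀ s, HasDerivAt κ (0, 0, 1, 0) s := fun s =>
    (hasDerivAt_const s 0).prodMk
      ((hasDerivAt_const s R).prodMk ((hasDerivAt_id s).prodMk (hasDerivAt_const s 0)))
  -- the time coordinate along the image of the timelike circle
  let f : ℝ → ℝ := fun s => d0 (e (cylMap (κ s)))
  have hf : ∀ s, HasDerivAt f
      (d0 (fderiv ℝ e (cylMap (κ s)) (fderiv ℝ cylMap (κ s) (0, 0, 1, 0)))) s := fun s => by
    have hm : cylMap (κ s) ∈ e.source := hs ▸ cylMap_mem (hκC s)
    have h1 : HasFDerivAt e (fderiv ℝ e (cylMap (κ s))) (cylMap (κ s)) :=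
      ((hd.1.contDiffAt (e.open_source.mem_nhds hm)).differentiableAt (by simp)).hasFDerivAt
    have h2 : HasFDerivAt cylMap (fderiv ℝ cylMap (κ s)) (κ s) :=
      (contDiff_cylMap.differentiable (by simp) _).hasFDerivAt
    exact d0.hasFDerivAt.comp_hasDerivAt s
      (h1.comp_hasDerivAt s (h2.comp_hasDerivAt s (hκ s)))
  have hper : f 0 = f (2 * Real.pi) := by simp [f, κ, cylMap]
  obtain ⟨s, -, hs0⟩ := exists_hasDerivAt_eq_zero (by positivity : (0 : ℝ) < 2 * Real.pi)
    (fun x _ => (hf x).continuousAt.continuousWithinAt) hper fun x _ => hf x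
  have hm : cylMap (κ s) ∈ e.source := hs ▸ cylMap_mem (hκC s)
  have hlt := hneg 0 s 0
  rw [← cylMap_pullsBackOn_weyl lam j α (κ s) (hκC s), ← hpb _ hm] at hlt
  exact absurd (lcForm_nonneg ha (Real.sqrt_nonneg _) n hs0) (not_le.2 hlt)

end LewisWeyl

end

theorem mainTheorem5 (lam j α : ℝ) (hα : 0 < α) (hlam : lam ≠ 1 / 4) (hj : j ≠ 0) :
    -- The cylindrical coordinates with `φ ~ φ + 2π` present the manifold `M = ℝ × (ℝ³ ∖ {r = 0})`.
    (cylMap '' Cyl = M ∧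
      (∀ c ∈ Cyl, ∃ e, IsDiffeo e ∧ c ∈ e.source ∧
        e.source ⊆ Cyl ∧ e.target ⊆ M ∧
        Set.EqOn e cylMap e.source) ∧
      (∀ c ∈ Cyl, ∀ c' ∈ Cyl, cylMap c = cylMap c' ↔
        ∃ k : ℤ, c' = c + (0, 0, 2 * Real.pi * k, 0))) ∧
    -- Both line elements are smooth Lorentzian metrics on this same manifold.
    (IsLorentzianOn (weylMetric lam j α) M ∧
      PullsBackOn cylMap (weylLine lam j α)
        (weylMetric lam j α) Cyl) ∧
    (∀ a n : ℝ, 0 < a →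
      IsLorentzianOn (lcMetric a n) M ∧
      PullsBackOn cylMap (lcLine a n)
        (lcMetric a n) Cyl) ∧
    -- The transformation puts the Weyl class line element into the Levi-Civita form.
    PullsBackOn (staticTransform lam j) (weylLine lam j α)
      (lcLine α⁻¹ (1 - 4 * lam)) Cyl ∧
    -- It is a local isometry: near every point each of its branches is an isometry.
    (∀ c ∈ Cyl, ∃ e,
      IsIsom (weylMetric lam j α)
        (lcMetric α⁻¹ (1 - 4 * lam)) e ∧
      e.source ⊆ M ∧ e.target ⊆ M ∧ cylMap c ∈ e.source ∧
      ∀ᶠ c' in 𝓝 c, e (cylMap c') =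
        cylMap (staticTransform lam j c')) ∧
    -- It is not a global diffeomorphism: it is neither single-valued nor injective,
    -- and no diffeomorphism of `M` onto itself realizes it.
    ((∀ p ∈ M, ∃ q q', q ≠ q' ∧
        InducedCorr lam j p q ∧ InducedCorr lam j p q') ∧
      (∀ q ∈ M, ∃ p p', p ≠ p' ∧
        InducedCorr lam j p q ∧ InducedCorr lam j p' q) ∧
      ¬ ∃ e, IsDiffeo e ∧ e.source = M ∧ e.target = M ∧
        ∀ p ∈ M, InducedCorr lam j p (e p)) ∧
    -- The two metrics are locally isometric,
    LocallyIsometric (weylMetric lam j α)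
      (lcMetric α⁻¹ (1 - 4 * lam)) ∧
    -- but the rotating metric is not globally isometric to any Levi-Civita metric.
    ∀ a n : ℝ, 0 < a →
      ¬ GloballyIsometric (weylMetric lam j α) (lcMetric a n) := by
  have hA := potA_ne_zero hlam hj
  exact ⟨⟨cylMap_image, fun c hc => exists_cylMap_diffeo hc,
      fun c hc c' hc' => cylMap_eq_iff hc hc'⟩,
    ⟨isLorentzianOn_weylMetric lam j hα, cylMap_pullsBackOn_weyl lam j α⟩,
    fun a n ha => ⟨isLorentzianOn_lcMetric ha n, cylMap_pullsBackOn_lc a n⟩,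
    staticTransform_pullsBackOn lam j α,
    fun c hc => exists_local_isometry lam j α hc,
    ⟨fun p hp => inducedCorr_not_single_valued hA hp,
      fun q hq => inducedCorr_not_injective hA hq,
      fun ⟨e, hd, hs, _, h⟩ => no_continuous_selection hA (hs ▸ hd.1.continuousOn) h⟩,
    locallyIsometric lam j α,
    fun a n ha => not_globallyIsometric hα hlam hA ha n⟩
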